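/- Let $\mathcal X$ be a measurable space and $\alpha\in[0,1]$. A symmetric regression algorithm $\mathcal A$ maps every finite data set in $(\mathcal X\times\mathbb R)^n$, $n\ge 0$, to a function $\hat\mu:\mathcal X\to\mathbb R$; the result does not depend on the order of the data, and $\hat\mu(x)$ is jointly measurable in the data and $x$. For a probability distribution $P$ on $\mathcal X\times\mathbb R$ and $m,n\ge 0$ put $$\beta^{\rm out}_{m,n}(\mathcal A,P)=\mathbb E\big[|\hat\mu_n(X)-\hat\mu_{n+m}(X)|\big]\in[0,\infty],$$ where $\hat\mu_k=\mathcal A((X_1,Y_1),\dots,(X_k,Y_k))$ and $(X_1,Y_1),\dots,(X_{n+m},Y_{n+m}),(X,Y)$ are i.i.d. from $P$; let $\beta^{*,\rm out}_{1,n}=\sup_{n'\ge n}\beta^{\rm out}_{1,n'}$. For a data set $\mathcal D_n=((X_i,Y_i))_{i\le n}$, $n\ge1$, let $\hat\mu_{-i}$ be the model fitted to $\mathcal D_n$ without its $i$-th point and $R_i=|Y_i-\hat\mu_{-i}(X_i)|$. For reals $v_1,\dots,v_n$ let $\mathrm{Quantile}(\{v_i\};\tau)=\inf\{t\in\mathbb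 R:\#\{i:v_i\le t\}\ge\tau n\}\in[-\infty,\infty]$. For $\gamma\ge0$ the $\gamma$-inflated jackknife+ interval at $x$ is $$\hat C_n^{\gamma\text{-J+}}(x)=\big\{y\in\mathbb R: -\mathrm{Quantile}(\{-\hat\mu_{-i}(x)+R_i\};\tau_n)-\gamma\le y\le \mathrm{Quantile}(\{\hat\mu_{-i}(x)+R_i\};\tau_n)+\gamma\big\},\qquad \tau_n=(1-\alpha)(1+1/n).$$ Its training-conditional miscoverage rate is $\alpha_P^{\gamma\text{-J+}}(\mathcal D_n)=\mathbb P\{Y\notin\hat C_n^{\gamma\text{-J+}}(X)\mid\mathcal D_n\}$, where $(X,Y)\sim P$ is independent of $\mathcal D_n$; for $\gamma=0$ write $\alpha_P^{\text{J+}}$. Below, $\mathcal D_n$ is an i.i.d. sample from $P$ of size $n$. (i) Let $b_n,\gamma_n>0$ with $b_n/\gamma_n\to0$. Put $m_n=\lceil (b_n/\gamma_n)^{-1/2}\rceil$ and $$\epsilon_n=\frac{3}{\sqrt[4]{4\min\{n,m_n\}}}+2\sqrt[3]{\frac{2m_nb_n}{\gamma_n}}.$$ Then $\epsilon_n\to0$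 and $$\lim_{n\to\infty}\ \sup_{\mathcal A,P:\ \beta^{*,\rm out}_{1,n-1}(\mathcal A,P)\le b_n}\mathbb P\big\{\alpha_P^{\gamma_n\text{-J+}}(\mathcal D_n)\ge\alpha+\epsilon_n\big\}=0 .$$ (ii) For $B>0$ let $\mathcal P_B$ be the set of distributions $P$ of $(X,Y)$ on $\mathcal X\times\mathbb R$ such that $Y\mid X$ has a conditional Lebesgue density $f_{Y|X}$ with $\mathbb E[\sup_{y\in\mathbb R}f_{Y|X}(y\mid X)]\le B$. Let $b_n,B_n>0$ with $b_nB_n\to0$. Put $m_n=\lceil (b_nB_n)^{-1/2}\rceil$ and $$\epsilon_n=\frac{3}{\sqrt[4]{4\min\{n,m_n\}}}+4\sqrt[4]{2B_nm_nb_n}.$$ Then $\epsilon_n\to0$ and $$\lim_{n\to\infty}\ \sup_{\mathcal A,\ P\in\mathcal P_{B_n}:\ \beta^{*,\rm out}_{1,n-1}(\mathcal A,P)\le b_n}\mathbb P\big\{\alpha_P^{\text{J+}}(\mathcal D_n)\ge\alpha+\epsilon_n\big\}=0 .$$ The suprema run over all symmetric algorithms $\mathcal A$ and all distributions $P$ with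 the stated properties. -/

import Mathlib

open MeasureTheory Filter Topology
open scoped ENNReal

noncomputable section

namespace JackknifePlus

/-- A symmetric regression algorithm on the feature space `𝒳`: it maps a training data set of any
size to a fitted regression function `𝒳 → ℝ`, and does not depend on the order of the data.
The prediction is jointly measurable in the training data and the test feature, so that
the fitted functions are measurable and expectations over random data sets make sense. -/
structure Algorithm (𝒳 : Type*) [MeasurableSpace 𝒳] where
  /-- the regression function fitted to a data set of size `n` -/
  fit : (n : ℕ) → (Fin n → 𝒳 × ℝ) → 𝒳 → ℝ
  measurable_fit : ∀ n, Measurable fun p : (Fin n → 𝒳 × ℝ) × 𝒳 => fit n p.1 p.2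
  symm : ∀ (n : ℕ) (π : Equiv.Perm (Fin n)) (D : Fin n → 𝒳 × ℝ),
    fit n (fun i => D (π i)) = fit n D

variable {𝒳 : Type*} [MeasurableSpace 𝒳]

/-- The law of an i.i.d. sample of size `n` from `P`. -/
def sampleLaw (P : ProbabilityMeasure (𝒳 × ℝ)) (n : ℕ) : Measure (Fin n → 𝒳 × ℝ) :=
  Measure.pi fun _ => (P : Measure (𝒳 × ℝ))

/-- Out-of-sample `m`-stability: the expectation of `|μ̂ₙ(X) - μ̂ₙ₊ₘ(X)|`, where the first model is
fitted to the first `n` points of an i.i.d. sample of size `n + m`, the second one to the whole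
sample, and `(X, Y)` is a further independent draw. -/
def betaOut (m n : ℕ) (A : Algorithm 𝒳) (P : ProbabilityMeasure (𝒳 × ℝ)) : ℝ≥0∞ :=
  ∫⁻ ω, ENNReal.ofReal
      |A.fit n (fun i => ω.1 (Fin.castAdd m i)) ω.2.1 - A.fit (n + m) ω.1 ω.2.1|
    ∂((sampleLaw P (n + m)).prod (P : Measure (𝒳 × ℝ)))

/-- The supremum of the out-of-sample `1`-stability over all sample sizes at least `n`. -/
def betaOutStar (n : ℕ) (A : Algorithm 𝒳) (P : ProbabilityMeasure (𝒳 × ℝ)) : ℝ≥0∞ :=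
  ⨆ (n' : ℕ) (_ : n ≤ n'), betaOut 1 n' A P

/-- The quantile at level `τ` of a finite list of reals: the smallest `t` such that at least a
fraction `τ` of the entries is `≤ t`. It is `⊤` for `τ > 1` (if the list is nonempty) and `⊥` for
`τ ≤ 0`. -/
def quantile {n : ℕ} (v : Fin n → ℝ) (τ : ℝ) : EReal :=
  ⨅ (t : ℝ) (_ : τ * n ≤ ((Finset.univ.filter fun i => v i ≤ t).card : ℝ)), (t : EReal)

/-- The data set with its `i`-th point removed. -/
def leaveOneOut : {n : ℕ} → (Fin n → 𝒳 × ℝ) → Fin n → (Fin (n - 1) → 𝒳 × ℝ)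
  | 0, _, i => i.elim0
  | _ + 1, D, i => fun j => D (i.succAbove j)

/-- The leave-one-out model: the model fitted without the `i`-th point. -/
def looFit (A : Algorithm 𝒳) {n : ℕ} (D : Fin n → 𝒳 × ℝ) (i : Fin n) : 𝒳 → ℝ :=
  A.fit (n - 1) (leaveOneOut D i)

/-- The leave-one-out residual of the `i`-th point. -/
def looResidual (A : Algorithm 𝒳) {n : ℕ} (D : Fin n → 𝒳 × ℝ) (i : Fin n) : ℝ :=
  |(D i).2 - looFit A D i (D i).1|

/-- The `γ`-inflated jackknife+ prediction interval at `x` with training data `D`; its endpoints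
may be infinite. For `γ = 0` this is the jackknife+ interval. -/
def interval (A : Algorithm 𝒳) (α γ : ℝ) {n : ℕ} (D : Fin n → 𝒳 × ℝ) (x : 𝒳) : Set ℝ :=
  {y : ℝ |
    -quantile (fun i => -looFit A D i x + looResidual A D i) ((1 - α) * (1 + 1 / (n : ℝ)))
        - (γ : EReal) ≤ (y : EReal) ∧
    (y : EReal) ≤
      quantile (fun i => looFit A D i x + looResidual A D i) ((1 - α) * (1 + 1 / (n : ℝ)))
        + (γ : EReal)}

/-- The training-conditional miscoverage rate of the `γ`-inflated jackknife+ interval: the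
probability that a new draw `(X, Y)` from `P`, independent of the training data `D`, has `Y`
outside the interval at `X`. -/
def miscoverage (A : Algorithm 𝒳) (P : ProbabilityMeasure (𝒳 × ℝ)) (α γ : ℝ) {n : ℕ}
    (D : Fin n → 𝒳 × ℝ) : ℝ :=
  (P : Measure (𝒳 × ℝ)).real {z | z.2 ∉ interval A α γ D z.1}

/-- The distributions of `(X, Y)` for which `Y` given `X` has a conditional Lebesgue density `f`
with `E[sup_y f(y | X)] ≤ B`. -/
def boundedDensity (𝒳 : Type*) [MeasurableSpace 𝒳] (B : ℝ) :
    Set (ProbabilityMeasure (𝒳 × ℝ)) :=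
  {P | ∃ f : 𝒳 → ℝ → ℝ≥0∞, Measurable (Function.uncurry f) ∧
    (P : Measure (𝒳 × ℝ)) =
      (((P : Measure (𝒳 × ℝ)).map Prod.fst).prod volume).withDensity (Function.uncurry f) ∧
    ∫⁻ x, ⨆ y : ℝ, f x y ∂((P : Measure (𝒳 × ℝ)).map Prod.fst) ≤ ENNReal.ofReal B}

/-- `⌈r ^ (-1/2)⌉`. -/
def steps (r : ℝ) : ℕ := ⌈r ^ (-(1 / 2) : ℝ)⌉₊

/-- The excess `ε_n` for the inflated interval, as a function of `n` and of `r = b_n / γ_n`. -/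
def epsInflated (n : ℕ) (r : ℝ) : ℝ :=
  3 / (4 * (min n (steps r) : ℕ) : ℝ) ^ (1 / 4 : ℝ) + 2 * (2 * (steps r : ℝ) * r) ^ (1 / 3 : ℝ)

/-- The excess `ε_n` for the uninflated interval, as a function of `n` and of `r = b_n B_n`. -/
def epsUninflated (n : ℕ) (r : ℝ) : ℝ :=
  3 / (4 * (min n (steps r) : ℕ) : ℝ) ^ (1 / 4 : ℝ) + 4 * (2 * (steps r : ℝ) * r) ^ (1 / 4 : ℝ)

end JackknifePlus

end

open JackknifePlus

open MeasureTheory Filter Topology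
open scoped ENNReal

noncomputable section

namespace JackknifePlus

variable {𝒳 : Type*} [MeasurableSpace 𝒳]

section FitOn

variable {ι : Type*}

/-- The model fitted to the data points whose indices lie in `s`. -/
def fitOn (A : Algorithm 𝒳) (s : Finset ι) (ω : ι → 𝒳 × ℝ) : 𝒳 → ℝ :=
  A.fit s.card fun j => ω (s.equivFin.symm j)

lemma fit_comp_eq_fitOn (A : Algorithm 𝒳) {k : ℕ} {e : Fin k → ι} (he : Function.Injective e)
    {s : Finset ι} (hs : ∀ i, i ∈ s ↔ ∃ j, e j = i) (ω : ι → 𝒳 × ℝ) :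
    A.fit k (fun j => ω (e j)) = fitOn A s ω := by
  have hbij : Function.Bijective (fun j => (⟨e j, (hs _).2 ⟨j, rfl⟩⟩ : s)) := by
    refine ⟨fun a b h => he (by simpa using h), ?_⟩
    rintro ⟨i, hi⟩
    obtain ⟨j, rfl⟩ := (hs i).1 hi
    exact ⟨j, rfl⟩
  have hk : k = s.card := by
    simpa using Fintype.card_congr (Equiv.ofBijective _ hbij)
  subst hk
  have h := A.symm s.card ((Equiv.ofBijective _ hbij).trans s.equivFin)
    (fun j => ω (s.equivFin.symm j))
  simpa [fitOn] using h

lemma fitOn_comp_perm (A : Algorithm 𝒳) (s : Finset ι) (π : Equiv.Perm ι) (ω : ι → 𝒳 × ℝ) :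
    fitOn A s (fun i => ω (π i)) = fitOn A (s.map π.toEmbedding) ω := by
  refine fit_comp_eq_fitOn A (e := fun j => π (s.equivFin.symm j)) ?_ ?_ ω
  · exact π.injective.comp (Subtype.val_injective.comp s.equivFin.symm.injective)
  · intro i
    simp only [Finset.mem_map_equiv]
    constructor
    · intro h
      exact ⟨s.equivFin ⟨_, h⟩, by simp⟩
    · rintro ⟨j, rfl⟩
      simp

lemma measurable_fitOn (A : Algorithm 𝒳) (s : Finset ι) {β : Type*} [MeasurableSpace β]
    {f : β → ι → 𝒳 × ℝ} (hf : Measurable f) {g : β → 𝒳} (hg : Measurable g) :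
    Measurable fun p => fitOn A s (f p) (g p) := by
  have h : Measurable fun p => ((fun j => f p (s.equivFin.symm j) : Fin s.card → 𝒳 × ℝ), g p) := by
    refine Measurable.prodMk (measurable_pi_lambda _ fun j => ?_) hg
    exact (measurable_pi_apply _).comp hf
  exact (A.measurable_fit s.card).comp h

lemma looFit_eq_fitOn (A : Algorithm 𝒳) {n : ℕ} {e : Fin n → ι} (he : Function.Injective e)
    (ω : ι → 𝒳 × ℝ) (i : Fin n) :
    looFit A (fun j => ω (e j)) i = fitOn A ((Finset.univ.erase i).map ⟨e, he⟩) ω := by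
  cases n with
  | zero => exact i.elim0
  | succ n =>
    refine fit_comp_eq_fitOn A (e := fun j => e (i.succAbove j)) ?_ ?_ ω
    · exact he.comp Fin.succAbove_right_injective
    · intro k
      simp only [Finset.mem_map, Finset.mem_erase, Finset.mem_univ, and_true,
        Function.Embedding.coeFn_mk]
      constructor
      · rintro ⟨a, ha, rfl⟩
        obtain ⟨b, rfl⟩ := Fin.exists_succAbove_eq ha
        exact ⟨b, rfl⟩
      · rintro ⟨j, rfl⟩
        exact ⟨_, Fin.succAbove_ne i j, rfl⟩

lemma measurable_looFit (A : Algorithm 𝒳) {n : ℕ} (i : Fin n) {β : Type*} [MeasurableSpace β]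
    {f : β → Fin n → 𝒳 × ℝ} (hf : Measurable f) {g : β → 𝒳} (hg : Measurable g) :
    Measurable fun p => looFit A (f p) i (g p) := by
  have h (p : β) : looFit A (f p) i (g p) =
      fitOn A ((Finset.univ.erase i).map ⟨id, Function.injective_id⟩) (f p) (g p) :=
    congrFun (looFit_eq_fitOn A Function.injective_id (f p) i) (g p)
  simp_rw [h]
  exact measurable_fitOn A _ hf hg

variable [Fintype ι] [DecidableEq ι]

/-- The leave-one-out residual of the data point with index `k`. -/
def score (A : Algorithm 𝒳) (ω : ι → 𝒳 × ℝ) (k : ι) : ℝ :=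
  |(ω k).2 - fitOn A (Finset.univ.erase k) ω (ω k).1|

lemma score_comp_perm (A : Algorithm 𝒳) (π : Equiv.Perm ι) (ω : ι → 𝒳 × ℝ) (k : ι) :
    score A (fun i => ω (π i)) k = score A ω (π k) := by
  have h : (Finset.univ.erase k).map π.toEmbedding = Finset.univ.erase (π k) := by
    ext i
    simp
  rw [score, fitOn_comp_perm, h, score]

lemma measurable_score (A : Algorithm 𝒳) (k : ι) :
    Measurable fun ω : ι → 𝒳 × ℝ => score A ω k := by
  have hk : Measurable fun ω : ι → 𝒳 × ℝ => ω k := measurable_pi_apply k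
  have := measurable_fitOn A (Finset.univ.erase k) (f := fun ω : ι → 𝒳 × ℝ => ω) measurable_id
    hk.fst
  unfold score
  exact (hk.snd.sub this).abs

end FitOn

section Stability

variable {ι : Type*} [Fintype ι]

lemma measurePreserving_comp_injective {Z : Type*} [MeasurableSpace Z] (P : Measure Z) [IsProbabilityMeasure P]
    {κ : Type*} [Fintype κ] {e : κ → ι} (he : Function.Injective e) :
    MeasurePreserving (fun (ω : ι → Z) j => ω (e j)) (Measure.pi fun _ => P)
      (Measure.pi fun _ => P) := by
  refine ⟨measurable_pi_lambda _ fun j => measurable_pi_apply _, ?_⟩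
  have h := ProbabilityTheory.iIndepFun_pi (ι := ι) (Ω := fun _ => Z) (μ := fun _ => P)
    (X := fun _ => id) (fun _ => aemeasurable_id)
  have h2 := h.precomp he
  have h3 := (ProbabilityTheory.iIndepFun_iff_map_fun_eq_pi_map
    (fun j => (measurable_pi_apply (e j)).aemeasurable)).1 h2
  refine h3.trans ?_
  congr 1
  ext1 j
  exact (measurePreserving_eval (fun _ : ι => P) (e j)).map_eq

lemma measurePreserving_comp_prod_eval {Z : Type*} [MeasurableSpace Z] (P : Measure Z)
    [IsProbabilityMeasure P] {M : ℕ} {e : Fin M → ι} (he : Function.Injective e) {k : ι}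
    (hk : ∀ j, e j ≠ k) :
    MeasurePreserving (fun (ω : ι → Z) => ((fun j => ω (e j)), ω k)) (Measure.pi fun _ => P)
      ((Measure.pi fun _ => P).prod P) := by
  have he' : Function.Injective (Fin.cons k e : Fin (M + 1) → ι) :=
    Fin.cons_injective_iff.2 ⟨fun ⟨j, hj⟩ => hk j hj, he⟩
  have h1 := measurePreserving_comp_injective P he'
  have h2 := measurePreserving_piFinSuccAbove (fun _ : Fin (M + 1) => P) 0
  exact (Measure.measurePreserving_swap.comp h2).comp h1

variable [DecidableEq ι]

lemma lintegral_fitOn_insert (A : Algorithm 𝒳) (P : ProbabilityMeasure (𝒳 × ℝ)) {s : Finset ι}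
    {a k : ι} (ha : a ∉ s) (hks : k ∉ s) (hka : k ≠ a) :
    ∫⁻ ω : ι → 𝒳 × ℝ, ENNReal.ofReal |fitOn A s ω (ω k).1 - fitOn A (insert a s) ω (ω k).1|
      ∂(Measure.pi fun _ => (P : Measure (𝒳 × ℝ))) = betaOut 1 s.card A P := by
  set e : Fin (s.card + 1) → ι :=
    Fin.snoc (α := fun _ => ι) (fun j => (s.equivFin.symm j : ι)) a with he_def
  have hecs (j : Fin s.card) : e (Fin.castAdd 1 j) = s.equivFin.symm j :=
    Fin.snoc_castSucc (α := fun _ => ι) _ _ j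
  have hel : e (Fin.last _) = a := Fin.snoc_last (α := fun _ => ι) _ _
  have he : Function.Injective e := by
    refine Fin.snoc_injective_iff.2 ⟨Subtype.val_injective.comp s.equivFin.symm.injective, ?_⟩
    rintro ⟨j, hj⟩
    exact ha (hj ▸ (s.equivFin.symm j).2)
  have hmem (i : ι) : i ∈ insert a s ↔ ∃ j, e j = i := by
    rw [Finset.mem_insert]
    constructor
    · rintro (rfl | hi)
      · exact ⟨_, hel⟩
      · exact ⟨Fin.castAdd 1 (s.equivFin ⟨i, hi⟩), by rw [hecs]; simp⟩
    · rintro ⟨j, rfl⟩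
      refine Fin.lastCases ?_ (fun j => ?_) j
      · exact Or.inl hel
      · right
        rw [show e j.castSucc = _ from hecs j]
        exact (s.equivFin.symm j).2
  have hek (j) : e j ≠ k := by
    intro h
    have := (hmem k).2 ⟨j, h⟩
    rw [Finset.mem_insert] at this
    tauto
  have hmp := measurePreserving_comp_prod_eval (P : Measure (𝒳 × ℝ)) he hek
  rw [betaOut, sampleLaw, ← hmp.lintegral_comp]
  · refine lintegral_congr fun ω => ?_
    rw [fit_comp_eq_fitOn A he hmem ω]
    simp only [hecs]
    rfl
  · have h1 : Measurable fun ω : (Fin (s.card + 1) → 𝒳 × ℝ) × (𝒳 × ℝ) =>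
        A.fit s.card (fun i => ω.1 (Fin.castAdd 1 i)) ω.2.1 := by
      refine (A.measurable_fit s.card).comp
        (f := fun ω : (Fin (s.card + 1) → 𝒳 × ℝ) × (𝒳 × ℝ) =>
          ((fun i => ω.1 (Fin.castAdd 1 i)), ω.2.1)) ?_
      fun_prop
    have h2 : Measurable fun ω : (Fin (s.card + 1) → 𝒳 × ℝ) × (𝒳 × ℝ) =>
        A.fit (s.card + 1) ω.1 ω.2.1 := by
      refine (A.measurable_fit (s.card + 1)).comp
        (f := fun ω : (Fin (s.card + 1) → 𝒳 × ℝ) × (𝒳 × ℝ) =>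
          (ω.1, ω.2.1)) ?_
      fun_prop
    exact (h1.sub h2).abs.ennreal_ofReal

lemma lintegral_fitOn_union_le (A : Algorithm 𝒳) (P : ProbabilityMeasure (𝒳 × ℝ)) {s : Finset ι}
    {k : ι} (hks : k ∉ s) (u : Finset ι) (hsu : Disjoint s u) (hku : k ∉ u) :
    ∫⁻ ω : ι → 𝒳 × ℝ, ENNReal.ofReal |fitOn A s ω (ω k).1 - fitOn A (s ∪ u) ω (ω k).1|
      ∂(Measure.pi fun _ => (P : Measure (𝒳 × ℝ))) ≤ u.card * betaOutStar s.card A P := by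
  induction u using Finset.induction_on with
  | empty => simp
  | insert a u ha ih =>
    rw [Finset.disjoint_insert_right] at hsu
    rw [Finset.mem_insert, not_or] at hku
    have hau : a ∉ s ∪ u := by simp [ha, hsu.1]
    have hkau : k ∉ s ∪ u := by simp [hks, hku.2]
    have hk1 : Measurable fun ω : ι → 𝒳 × ℝ => (ω k).1 := (measurable_pi_apply k).fst
    have hm (t : Finset ι) := measurable_fitOn A t (f := fun ω : ι → 𝒳 × ℝ => ω) measurable_id hk1
    calc
      _ ≤ ∫⁻ ω : ι → 𝒳 × ℝ, (ENNReal.ofReal |fitOn A s ω (ω k).1 - fitOn A (s ∪ u) ω (ω k).1| +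
            ENNReal.ofReal
              |fitOn A (s ∪ u) ω (ω k).1 - fitOn A (insert a (s ∪ u)) ω (ω k).1|)
          ∂(Measure.pi fun _ => (P : Measure (𝒳 × ℝ))) := by
        refine lintegral_mono fun ω => ?_
        rw [← ENNReal.ofReal_add (abs_nonneg _) (abs_nonneg _), Finset.union_insert]
        exact ENNReal.ofReal_le_ofReal (abs_sub_le _ _ _)
      _ ≤ u.card * betaOutStar s.card A P + betaOutStar s.card A P := by
        have hd : Measurable fun ω : ι → 𝒳 × ℝ =>
            ENNReal.ofReal |fitOn A s ω (ω k).1 - fitOn A (s ∪ u) ω (ω k).1| :=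
          ((hm s).sub (hm (s ∪ u))).abs.ennreal_ofReal
        rw [lintegral_add_left hd,
          lintegral_fitOn_insert A P hau hkau hku.1]
        refine add_le_add (ih hsu.2 hku.2) ?_
        exact le_iSup₂_of_le (s ∪ u).card (Finset.card_le_card Finset.subset_union_left) le_rfl
      _ = _ := by
        rw [Finset.card_insert_of_notMem ha]
        push_cast
        ring

lemma lintegral_fitOn_subset_le (A : Algorithm 𝒳) (P : ProbabilityMeasure (𝒳 × ℝ))
    {s t : Finset ι} (hst : s ⊆ t) {k : ι} (hk : k ∉ t) :
    ∫⁻ ω : ι → 𝒳 × ℝ, ENNReal.ofReal |fitOn A s ω (ω k).1 - fitOn A t ω (ω k).1|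
      ∂(Measure.pi fun _ => (P : Measure (𝒳 × ℝ))) ≤
      (t.card - s.card : ℕ) * betaOutStar s.card A P := by
  have h := lintegral_fitOn_union_le A P (fun h => hk (hst h)) (t \ s) Finset.disjoint_sdiff
    (fun h => hk (Finset.sdiff_subset h))
  rwa [Finset.union_sdiff_of_subset hst, Finset.card_sdiff_of_subset hst] at h

end Stability

section Exchangeable

variable {ι : Type*} [Fintype ι] {Z : Type*} [MeasurableSpace Z]

lemma measurePreserving_comp_perm (P : Measure Z) [IsProbabilityMeasure P] (π : Equiv.Perm ι) :
    MeasurePreserving (fun (ω : ι → Z) i => ω (π i)) (Measure.pi fun _ => P)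
      (Measure.pi fun _ => P) :=
  measurePreserving_comp_injective P π.injective

variable [DecidableEq ι]

/-- For an exchangeable family of bounded variables that sum to zero, the variables are
nonpositively correlated. -/
lemma integral_mul_nonpos_of_exchangeable (P : Measure Z) [IsProbabilityMeasure P]
    {c : (ι → Z) → ι → ℝ} (hc : ∀ k, Measurable fun ω => c ω k) (hb : ∀ ω k, |c ω k| ≤ 1)
    (hπ : ∀ (π : Equiv.Perm ι) ω k, c (fun i => ω (π i)) k = c ω (π k))
    (hsum : ∀ ω, ∑ k, c ω k = 0) {k l : ι} (hkl : k ≠ l) :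
    ∫ ω, c ω k * c ω l ∂(Measure.pi fun _ => P) ≤ 0 := by
  set μ : Measure (ι → Z) := Measure.pi fun _ => P
  have hint (i j : ι) : Integrable (fun ω => c ω i * c ω j) μ := by
    refine Integrable.of_bound ((hc i).mul (hc j)).aestronglyMeasurable 1 (ae_of_all _ fun ω => ?_)
    rw [Real.norm_eq_abs, abs_mul]
    exact mul_le_one₀ (hb ω i) (abs_nonneg _) (hb ω j)
  have heq (j : ι) (hj : j ∈ Finset.univ.erase k) :
      ∫ ω, c ω k * c ω j ∂μ = ∫ ω, c ω k * c ω l ∂μ := by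
    have hjk : j ≠ k := Finset.ne_of_mem_erase hj
    have hmp := measurePreserving_comp_perm P (Equiv.swap j l)
    have h := integral_map hmp.measurable.aemeasurable (μ := μ)
      (f := fun ω => c ω k * c ω j) (by rw [hmp.map_eq]; exact (hint k j).1)
    rw [hmp.map_eq] at h
    rw [h]
    simp_rw [hπ, Equiv.swap_apply_left, Equiv.swap_apply_of_ne_of_ne hjk.symm hkl]
  have h0 : ∫ ω, c ω k * c ω k ∂μ + (Finset.univ.erase k).card * ∫ ω, c ω k * c ω l ∂μ = 0 := by
    rw [← nsmul_eq_mul, ← Finset.sum_const, ← Finset.sum_congr rfl heq,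
      Finset.add_sum_erase _ (fun j => ∫ ω, c ω k * c ω j ∂μ) (Finset.mem_univ k),
      ← integral_finsetSum _ fun j _ => hint k j]
    simp_rw [← Finset.mul_sum, hsum, mul_zero, integral_zero]
  have h1 : 0 ≤ ∫ ω, c ω k * c ω k ∂μ := integral_nonneg fun ω => mul_self_nonneg _
  have h2 : 0 < ((Finset.univ.erase k).card : ℝ) := by
    exact_mod_cast Finset.card_pos.2 ⟨l, by simp [hkl.symm]⟩
  by_contra! h3
  have := mul_pos h2 h3
  linarith

lemma measure_sum_ge_le_of_exchangeable (P : Measure Z) [IsProbabilityMeasure P]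
    {c : (ι → Z) → ι → ℝ} (hc : ∀ k, Measurable fun ω => c ω k) (hb : ∀ ω k, |c ω k| ≤ 1)
    (hπ : ∀ (π : Equiv.Perm ι) ω k, c (fun i => ω (π i)) k = c ω (π k))
    (hsum : ∀ ω, ∑ k, c ω k = 0) {J : Finset ι} (hJ : J.Nonempty) {η : ℝ} (hη : 0 < η) :
    (Measure.pi fun _ => P).real {ω | J.card * η ≤ ∑ k ∈ J, c ω k} ≤ 1 / (J.card * η ^ 2) := by
  set μ : Measure (ι → Z) := Measure.pi fun _ => P
  have hint (i j : ι) : Integrable (fun ω => c ω i * c ω j) μ := by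
    refine Integrable.of_bound ((hc i).mul (hc j)).aestronglyMeasurable 1 (ae_of_all _ fun ω => ?_)
    rw [Real.norm_eq_abs, abs_mul]
    exact mul_le_one₀ (hb ω i) (abs_nonneg _) (hb ω j)
  have hJ0 : 0 < (J.card : ℝ) := by exact_mod_cast hJ.card_pos
  have hexp (ω) : (∑ k ∈ J, c ω k) ^ 2 = ∑ k ∈ J, ∑ l ∈ J, c ω k * c ω l := by
    rw [sq, Finset.sum_mul_sum]
  have hint2 : Integrable (fun ω => (∑ k ∈ J, c ω k) ^ 2) μ := by
    simp_rw [hexp]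
    exact integrable_finsetSum _ fun k _ => integrable_finsetSum _ fun l _ => hint k l
  have hvar : ∫ ω, (∑ k ∈ J, c ω k) ^ 2 ∂μ ≤ J.card := by
    simp_rw [hexp]
    rw [integral_finsetSum _ fun k _ => integrable_finsetSum _ fun l _ => hint k l]
    calc
      _ ≤ ∑ k ∈ J, (1 : ℝ) := by
        refine Finset.sum_le_sum fun k hk => ?_
        rw [integral_finsetSum _ fun l _ => hint k l, ← Finset.add_sum_erase _ _ hk]
        have h1 : ∫ ω, c ω k * c ω k ∂μ ≤ 1 := by
          have : ∫ ω, c ω k * c ω k ∂μ ≤ ∫ _, (1 : ℝ) ∂μ :=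
            integral_mono (hint k k) (integrable_const _) fun ω =>
              (le_abs_self _).trans (by
                rw [abs_mul]; exact mul_le_one₀ (hb ω k) (abs_nonneg _) (hb ω k))
          simpa using this
        have h2 : ∑ l ∈ J.erase k, ∫ ω, c ω k * c ω l ∂μ ≤ 0 :=
          Finset.sum_nonpos fun l hl =>
            integral_mul_nonpos_of_exchangeable P hc hb hπ hsum (Finset.ne_of_mem_erase hl).symm
        linarith
      _ = _ := by simp
  have hmarkov := mul_meas_ge_le_integral_of_nonneg (ae_of_all μ fun ω => sq_nonneg _) hint2
    ((J.card * η) ^ 2)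
  have hsub : μ.real {ω | J.card * η ≤ ∑ k ∈ J, c ω k} ≤
      μ.real {ω | (J.card * η) ^ 2 ≤ (∑ k ∈ J, c ω k) ^ 2} :=
    measureReal_mono fun ω hω => by
      simp only [Set.mem_ofPred_eq] at hω ⊢
      gcongr
  rw [le_div_iff₀ (by positivity)]
  have h3 := (mul_le_mul_of_nonneg_left hsub (sq_nonneg (J.card * η))).trans (hmarkov.trans hvar)
  have h4 : (J.card : ℝ) * (μ.real {ω | J.card * η ≤ ∑ k ∈ J, c ω k} * (J.card * η ^ 2)) ≤
      J.card * 1 := by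
    linarith
  exact le_of_mul_le_mul_left h4 hJ0

/-- An exchangeable random subset of the index set meets a fixed set `J` of indices in about the
expected proportion. -/
lemma measure_card_inter_ge_le (P : Measure Z) [IsProbabilityMeasure P]
    {T : (ι → Z) → Finset ι} (hT : ∀ k, MeasurableSet {ω | k ∈ T ω})
    (hπ : ∀ (π : Equiv.Perm ι) ω k, k ∈ T (fun i => ω (π i)) ↔ π k ∈ T ω)
    {J : Finset ι} (hJ : J.Nonempty) {η : ℝ} (hη : 0 < η) :
    (Measure.pi fun _ => P).real
      {ω | J.card * ((T ω).card / (Fintype.card ι : ℝ) + η) ≤ (J ∩ T ω).card} ≤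
      1 / (J.card * η ^ 2) := by
  classical
  have : Nonempty ι := ⟨hJ.choose⟩
  have hN : 0 < (Fintype.card ι : ℝ) := by exact_mod_cast Fintype.card_pos
  have hcard (ω) : ((T ω).card : ℝ) = ∑ k, if k ∈ T ω then (1 : ℝ) else 0 := by
    simp
  have hcard_perm (π : Equiv.Perm ι) (ω) : (T (fun i => ω (π i))).card = (T ω).card := by
    refine Finset.card_bij (fun k _ => π k) (fun k hk => (hπ π ω k).1 hk)
      (fun _ _ _ _ h => π.injective h) (fun k hk => ⟨π.symm k, ?_, by simp⟩)
    rw [hπ]; simpa using hk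
  have hle (ω) : ((T ω).card : ℝ) / Fintype.card ι ≤ 1 := by
    rw [div_le_one hN]
    exact_mod_cast Finset.card_le_univ _
  have hnn (ω) : 0 ≤ ((T ω).card : ℝ) / Fintype.card ι := by positivity
  refine le_trans (measureReal_mono ?_) (measure_sum_ge_le_of_exchangeable P
    (c := fun ω k => (if k ∈ T ω then (1 : ℝ) else 0) - (T ω).card / Fintype.card ι)
    ?_ ?_ ?_ ?_ hJ hη)
  · intro ω hω
    simp only [Set.mem_ofPred_eq, Finset.sum_sub_distrib, Finset.sum_const, nsmul_eq_mul,
      Finset.sum_boole, Finset.filter_mem_eq_inter] at hω ⊢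
    linarith
  · intro k
    simp_rw [hcard]
    have hm (k : ι) : Measurable fun ω => if k ∈ T ω then (1 : ℝ) else 0 :=
      Measurable.ite (hT k) measurable_const measurable_const
    exact (hm k).sub ((Finset.measurable_sum _ fun k _ => hm k).div_const _)
  · intro ω k
    have := hle ω
    have := hnn ω
    rw [abs_le]
    split_ifs <;> constructor <;> linarith
  · intro π ω k
    simp only [hπ, hcard_perm]
  · intro ω
    rw [Finset.sum_sub_distrib, ← hcard, Finset.sum_const, Finset.card_univ, nsmul_eq_mul,
      mul_div_cancel₀ _ hN.ne', sub_self]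

end Exchangeable

section Ranks

variable {Z : Type*} [MeasurableSpace Z]

lemma measurableSet_le_card_filter {Ω : Type*} [MeasurableSpace Ω] {κ : Type*} [Fintype κ]
    {p : Ω → κ → Prop} [∀ ω, DecidablePred (p ω)] (hp : ∀ k, MeasurableSet {ω | p ω k}) (c : ℝ) :
    MeasurableSet {ω | c ≤ ((Finset.univ.filter (p ω)).card : ℝ)} := by
  have h (ω) : ((Finset.univ.filter (p ω)).card : ℝ) = ∑ k, if p ω k then (1 : ℝ) else 0 := by
    simp
  simp_rw [h]
  exact measurableSet_le measurable_const
    (Finset.measurable_sum _ fun k _ => Measurable.ite (hp k) measurable_const measurable_const)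

/-- Exchangeable scores: the proportion of test scores that exceed a fraction `1 - a` of the
training scores is not much more than `a`. -/
lemma measure_card_rank_ge_le (P : Measure Z) [IsProbabilityMeasure P] {n m : ℕ} (hn : 0 < n)
    (hm : 0 < m) {r : (Fin n ⊕ Fin m → Z) → Fin n ⊕ Fin m → ℝ}
    (hr : ∀ k, Measurable fun ω => r ω k)
    (hπ : ∀ (π : Equiv.Perm (Fin n ⊕ Fin m)) ω k, r (fun i => ω (π i)) k = r ω (π k))
    {a η : ℝ} (ha : 0 ≤ a) (hη : 0 < η) :
    (Measure.pi fun _ => P).real {ω | m * (a + 2 * η) ≤ ((Finset.univ.filter fun j : Fin m =>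
      (1 - a) * n ≤ ((Finset.univ.filter fun i : Fin n =>
        r ω (Sum.inl i) < r ω (Sum.inr j)).card : ℝ)).card : ℝ)} ≤
      1 / (m * η ^ 2) + 1 / (n * η ^ 2) := by
  classical
  obtain ⟨N, hN⟩ : ∃ N : ℝ, N = Fintype.card (Fin n ⊕ Fin m) := ⟨_, rfl⟩
  have hN0 : 0 < N := by
    rw [hN]; simp only [Fintype.card_sum, Fintype.card_fin]; positivity
  set below : (Fin n ⊕ Fin m → Z) → Fin n ⊕ Fin m → Finset (Fin n ⊕ Fin m) :=
    fun ω k => Finset.univ.filter fun l => r ω l < r ω k with hbelow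
  set T : (Fin n ⊕ Fin m → Z) → Finset (Fin n ⊕ Fin m) :=
    fun ω => Finset.univ.filter fun k => (1 - a - η) * N ≤ ((below ω k).card : ℝ) with hT
  set S : (Fin n ⊕ Fin m → Z) → Finset (Fin n ⊕ Fin m) :=
    fun ω => Finset.univ.filter fun l => ∃ k, k ∉ T ω ∧ r ω l < r ω k with hS
  have hlt (l k) : MeasurableSet {ω | r ω l < r ω k} := measurableSet_lt (hr l) (hr k)
  have hTm (k) : MeasurableSet {ω | k ∈ T ω} := by
    simp only [hT, hbelow, Finset.mem_filter, Finset.mem_univ, true_and]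
    exact measurableSet_le_card_filter (fun l => hlt l k) _
  have hSm (l) : MeasurableSet {ω | l ∈ S ω} := by
    have : {ω | l ∈ S ω} = ⋃ k, {ω | k ∈ T ω}ᶜ ∩ {ω | r ω l < r ω k} := by
      ext ω; simp [hS]
    rw [this]
    exact MeasurableSet.iUnion fun k => (hTm k).compl.inter (hlt l k)
  have hbπ (π : Equiv.Perm (Fin n ⊕ Fin m)) (ω k) :
      (below (fun i => ω (π i)) k).card = (below ω (π k)).card := by
    refine Finset.card_bij (fun l _ => π l) (fun l hl => ?_) (fun _ _ _ _ h => π.injective h)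
      (fun l hl => ⟨π.symm l, ?_, by simp⟩)
    · simpa [hbelow, hπ] using hl
    · simpa [hbelow, hπ] using hl
  have hTπ (π : Equiv.Perm (Fin n ⊕ Fin m)) (ω k) : k ∈ T (fun i => ω (π i)) ↔ π k ∈ T ω := by
    simp only [hT, Finset.mem_filter, Finset.mem_univ, true_and, hbπ]
  have hSπ (π : Equiv.Perm (Fin n ⊕ Fin m)) (ω l) : l ∈ S (fun i => ω (π i)) ↔ π l ∈ S ω := by
    simp only [hS, Finset.mem_filter, Finset.mem_univ, true_and, hTπ, hπ]
    constructor
    · rintro ⟨k, h1, h2⟩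
      exact ⟨π k, h1, h2⟩
    · rintro ⟨k, h1, h2⟩
      exact ⟨π.symm k, by simpa using h1, by simpa using h2⟩
  have hTcard (ω) : ((T ω).card : ℝ) ≤ (a + η) * N := by
    rcases (T ω).eq_empty_or_nonempty with h | h
    · rw [h]; simp only [Finset.card_empty, Nat.cast_zero]; positivity
    · obtain ⟨k, hk, hmin⟩ := Finset.exists_min_image (T ω) (r ω) h
      have hd : Disjoint (T ω) (below ω k) := by
        rw [Finset.disjoint_left]
        intro l hl hl2
        simp only [hbelow, Finset.mem_filter, Finset.mem_univ, true_and] at hl2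
        exact absurd hl2 (not_lt.2 (hmin l hl))
      have h1 : ((T ω).card : ℝ) + (below ω k).card ≤ N := by
        rw [hN, ← Nat.cast_add, ← Finset.card_union_of_disjoint hd]
        exact_mod_cast Finset.card_le_univ _
      have h2 : (1 - a - η) * N ≤ (below ω k).card := by simpa [hT] using hk
      linarith
  have hScard (ω) (h : ∃ k, k ∉ T ω) : ((S ω).card : ℝ) ≤ (1 - a - η) * N := by
    obtain ⟨k, hk, hmax⟩ := Finset.exists_max_image (T ω)ᶜ (r ω)
      (h.imp fun k hk => Finset.mem_compl.2 hk)
    have h1 : (S ω).card ≤ (below ω k).card := by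
      refine Finset.card_le_card fun l hl => ?_
      simp only [hS, hbelow, Finset.mem_filter, Finset.mem_univ, true_and] at hl ⊢
      obtain ⟨k', h1, h2⟩ := hl
      exact h2.trans_le (hmax k' (Finset.mem_compl.2 h1))
    have h2 : ((below ω k).card : ℝ) < (1 - a - η) * N := by simpa [hT] using hk
    have h3 : ((S ω).card : ℝ) ≤ (below ω k).card := by exact_mod_cast h1
    linarith
  have hmR : (0 : ℝ) < m := by exact_mod_cast hm
  have hnR : (0 : ℝ) < n := by exact_mod_cast hn
  set Jm : Finset (Fin n ⊕ Fin m) := Finset.univ.map Function.Embedding.inr with hJm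
  set Jn : Finset (Fin n ⊕ Fin m) := Finset.univ.map Function.Embedding.inl with hJn
  have hJmc : Jm.card = m := by simp [hJm]
  have hJnc : Jn.card = n := by simp [hJn]
  have hb1 := measure_card_inter_ge_le P hTm hTπ (J := Jm)
    (Finset.card_pos.1 (by omega)) hη
  have hb2 := measure_card_inter_ge_le P hSm hSπ (J := Jn)
    (Finset.card_pos.1 (by omega)) hη
  rw [hJmc, ← hN] at hb1
  rw [hJnc, ← hN] at hb2
  refine le_trans (measureReal_mono ?_) ((measureReal_union_le _ _).trans (add_le_add hb1 hb2))
  intro ω hω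
  simp only [Set.mem_ofPred_eq, Set.mem_union] at hω ⊢
  by_cases hall : ∀ j : Fin m, (1 - a) * n ≤ ((Finset.univ.filter fun i : Fin n =>
        r ω (Sum.inl i) < r ω (Sum.inr j)).card : ℝ) → Sum.inr j ∈ T ω
  · left
    have h1 : (T ω).card / N ≤ a + η := by
      rw [div_le_iff₀ hN0]; exact hTcard ω
    have h2 : (Finset.univ.filter fun j : Fin m =>
      (1 - a) * n ≤ ((Finset.univ.filter fun i : Fin n =>
        r ω (Sum.inl i) < r ω (Sum.inr j)).card : ℝ)).card ≤ (Jm ∩ T ω).card := by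
      rw [← Finset.card_map (Function.Embedding.inr : Fin m ↪ Fin n ⊕ Fin m)]
      refine Finset.card_le_card fun k hk => ?_
      obtain ⟨j, hj, rfl⟩ := Finset.mem_map.1 hk
      exact Finset.mem_inter.2 ⟨by simp [hJm], hall j (Finset.mem_filter.1 hj).2⟩
    calc
      _ ≤ m * (a + 2 * η) := mul_le_mul_of_nonneg_left (by linarith) hmR.le
      _ ≤ _ := hω.trans (by exact_mod_cast h2)
  · right
    push Not at hall
    obtain ⟨j, hj, hjT⟩ := hall
    have h1 : (S ω).card / N ≤ 1 - a - η := by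
      rw [div_le_iff₀ hN0]; exact hScard ω ⟨_, hjT⟩
    have h2 : (Finset.univ.filter fun i : Fin n =>
        r ω (Sum.inl i) < r ω (Sum.inr j)).card ≤ (Jn ∩ S ω).card := by
      rw [← Finset.card_map (Function.Embedding.inl : Fin n ↪ Fin n ⊕ Fin m)]
      refine Finset.card_le_card fun k hk => ?_
      obtain ⟨i, hi, rfl⟩ := Finset.mem_map.1 hk
      refine Finset.mem_inter.2 ⟨by simp [hJn], ?_⟩
      simp only [hS, Finset.mem_filter, Finset.mem_univ, true_and]
      exact ⟨_, hjT, (Finset.mem_filter.1 hi).2⟩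
    calc
      _ ≤ n * (1 - a) := mul_le_mul_of_nonneg_left (by linarith) hnR.le
      _ = (1 - a) * n := mul_comm _ _
      _ ≤ _ := hj.trans (by exact_mod_cast h2)

/-- Chebyshev's inequality for the empirical frequency of a set in an i.i.d. sample. -/
lemma measure_card_mem_le_le (P : Measure Z) [IsProbabilityMeasure P] {m : ℕ} (hm : 0 < m)
    {G : Set Z} [DecidablePred (· ∈ G)] (hG : MeasurableSet G) {η : ℝ} (hη : 0 < η) :
    (Measure.pi fun _ : Fin m => P).real
      {ω | ((Finset.univ.filter fun j => ω j ∈ G).card : ℝ) ≤ m * (P.real G - η)} ≤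
      1 / (m * η ^ 2) := by
  have hmR : (0 : ℝ) < m := by exact_mod_cast hm
  set X : Z → ℝ := fun z => if z ∈ G then 1 else 0 with hX
  have hXm : Measurable X := Measurable.ite hG measurable_const measurable_const
  have hXb (z) : X z ∈ Set.Icc (0 : ℝ) 1 := by
    simp only [hX]; split_ifs <;> simp
  have hXL : MemLp X 2 P := MemLp.of_bound hXm.aestronglyMeasurable 1 (ae_of_all _ fun z => by
    rw [Real.norm_eq_abs, abs_of_nonneg (hXb z).1]; exact (hXb z).2)
  have hXi : ∫ z, X z ∂P = P.real G := by
    have : X = G.indicator fun _ => (1 : ℝ) := by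
      ext z; simp [hX, Set.indicator_apply]
    rw [this, integral_indicator_const _ hG]; simp
  set μ : Measure (Fin m → Z) := Measure.pi fun _ => P
  set Y : (Fin m → Z) → ℝ := ∑ j, fun ω => X (ω j) with hY
  have hmp (j) : MeasurePreserving (fun ω : Fin m → Z => ω j) μ P :=
    measurePreserving_eval (fun _ : Fin m => P) j
  have hYL : MemLp Y 2 μ := memLp_finsetSum' _ fun j _ => hXL.comp_measurePreserving (hmp j)
  have hYi : ∫ ω, Y ω ∂μ = m * P.real G := by
    have h (j : Fin m) : ∫ ω : Fin m → Z, X (ω j) ∂μ = P.real G := by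
      rw [← hXi, ← (hmp j).map_eq, integral_map (hmp j).measurable.aemeasurable]
      exact hXm.aestronglyMeasurable
    simp only [hY, Finset.sum_apply]
    have hint (j : Fin m) : Integrable (fun ω : Fin m → Z => X (ω j)) μ :=
      (hXL.comp_measurePreserving (hmp j)).integrable one_le_two
    rw [integral_finsetSum _ fun j _ => hint j]
    simp [h]
  have hvar : ProbabilityTheory.variance Y μ ≤ m := by
    rw [hY, ProbabilityTheory.variance_sum_pi (X := fun _ => X) fun _ => hXL]
    calc
      _ ≤ ∑ _ : Fin m, (1 : ℝ) := Finset.sum_le_sum fun j _ =>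
        (ProbabilityTheory.variance_le_sq_of_bounded (ae_of_all _ hXb) hXm.aemeasurable).trans
          (by norm_num)
      _ = m := by simp
  have hch := ProbabilityTheory.meas_ge_le_variance_div_sq hYL (c := m * η) (by positivity)
  calc
    _ ≤ μ.real {ω | m * η ≤ |Y ω - ∫ ω, Y ω ∂μ|} := by
      refine measureReal_mono fun ω hω => ?_
      have h : Y ω = ((Finset.univ.filter fun j => ω j ∈ G).card : ℝ) := by
        simp [hY, hX]
      simp only [Set.mem_ofPred_eq] at hω ⊢
      rw [hYi, h]
      refine le_trans ?_ (neg_le_abs _)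
      linarith
    _ ≤ ProbabilityTheory.variance Y μ / (m * η) ^ 2 :=
      ENNReal.toReal_le_of_le_ofReal (by
        have := ProbabilityTheory.variance_nonneg Y μ
        positivity) hch
    _ ≤ m / (m * η) ^ 2 := by gcongr
    _ = _ := by field_simp

/-- If the conditional probability of a set `G` given the data exceeds `c + η`, then most probably
its frequency in an independent test sample exceeds `c`. -/
lemma measure_le_of_test_sample {Ω : Type*} [MeasurableSpace Ω] (ν : Measure Ω)
    [IsProbabilityMeasure ν] (P : Measure Z) [IsProbabilityMeasure P] {m : ℕ} (hm : 0 < m)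
    {G : Ω → Set Z} [∀ D, DecidablePred (· ∈ G D)] (hG : MeasurableSet {p : Ω × Z | p.2 ∈ G p.1})
    {c η : ℝ} (hη : 0 < η) :
    ν.real {D | c + η ≤ P.real (G D)} ≤ 1 / (m * η ^ 2) +
      (ν.prod (Measure.pi fun _ : Fin m => P)).real
        {p | m * c ≤ ((Finset.univ.filter fun j => p.2 j ∈ G p.1).card : ℝ)} := by
  have hmR : (0 : ℝ) < m := by exact_mod_cast hm
  have hGD (D) : MeasurableSet (G D) := hG.preimage measurable_prodMk_left
  have hPm : Measurable fun D => P.real (G D) := (measurable_measure_prodMk_left hG).ennreal_toReal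
  set Q : Measure (Fin m → Z) := Measure.pi fun _ => P
  have hcard : Measurable fun p : Ω × (Fin m → Z) =>
      ((Finset.univ.filter fun j => p.2 j ∈ G p.1).card : ℝ) := by
    have h (p : Ω × (Fin m → Z)) : ((Finset.univ.filter fun j => p.2 j ∈ G p.1).card : ℝ) =
        ∑ j, if p.2 j ∈ G p.1 then (1 : ℝ) else 0 := by simp
    simp_rw [h]
    refine Finset.measurable_sum _ fun j _ => Measurable.ite ?_ measurable_const measurable_const
    exact hG.preimage (f := fun p : Ω × (Fin m → Z) => (p.1, p.2 j)) (by fun_prop)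
  set bad : Set (Ω × (Fin m → Z)) := {p |
    ((Finset.univ.filter fun j => p.2 j ∈ G p.1).card : ℝ) ≤ m * (P.real (G p.1) - η)} with hbad
  have hbadm : MeasurableSet bad :=
    measurableSet_le hcard (((hPm.comp measurable_fst).sub_const η).const_mul _)
  have hbadle : (ν.prod Q).real bad ≤ 1 / (m * η ^ 2) := by
    refine ENNReal.toReal_le_of_le_ofReal (by positivity) ?_
    rw [Measure.prod_apply hbadm]
    calc
      _ ≤ ∫⁻ _, ENNReal.ofReal (1 / (m * η ^ 2)) ∂ν := by
        refine lintegral_mono fun D => ?_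
        rw [← ENNReal.ofReal_toReal (measure_ne_top Q _)]
        exact ENNReal.ofReal_le_ofReal (measure_card_mem_le_le P hm (hGD D) hη)
      _ = _ := by simp
  have hfst : ν.real {D | c + η ≤ P.real (G D)} =
      (ν.prod Q).real {p | c + η ≤ P.real (G p.1)} := by
    have h := (measurePreserving_fst (μ := ν) (ν := Q)).measure_preimage
      (measurableSet_le measurable_const hPm :
        MeasurableSet {D | c + η ≤ P.real (G D)}).nullMeasurableSet
    rw [measureReal_def, ← h]
    rfl
  rw [hfst]
  refine le_trans (measureReal_mono ?_)
    ((measureReal_union_le _ _).trans (add_le_add_left hbadle _))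
  intro p hp
  simp only [Set.mem_union, Set.mem_ofPred_eq, hbad] at hp ⊢
  by_contra! h
  have : (m : ℝ) * c ≤ m * (P.real (G p.1) - η) := by gcongr; linarith
  linarith

end Ranks

section Interval

lemma quantile_lt_coe_iff {n : ℕ} (v : Fin n → ℝ) (τ y : ℝ) :
    quantile v τ < (y : EReal) ↔
      τ * n ≤ ((Finset.univ.filter fun i => v i < y).card : ℝ) := by
  simp only [quantile, iInf_lt_iff, EReal.coe_lt_coe_iff, exists_prop]
  constructor
  · rintro ⟨t, ht, hty⟩
    refine ht.trans (Nat.cast_le.2 (Finset.card_le_card ?_))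
    intro i hi
    simp only [Finset.mem_filter, Finset.mem_univ, true_and] at hi ⊢
    exact hi.trans_lt hty
  · intro h
    set F := insert (y - 1) ((Finset.univ.filter fun i => v i < y).image v) with hF
    have hne : F.Nonempty := Finset.insert_nonempty _ _
    refine ⟨F.max' hne, h.trans (Nat.cast_le.2 (Finset.card_le_card ?_)), ?_⟩
    · intro i hi
      have hmem : v i ∈ F := Finset.mem_insert_of_mem (Finset.mem_image_of_mem v hi)
      simpa using F.le_max' _ hmem
    · rw [Finset.max'_lt_iff]
      intro x hx
      rcases Finset.mem_insert.1 hx with rfl | hx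
      · linarith
      · obtain ⟨i, hi, rfl⟩ := Finset.mem_image.1 hx
        exact (Finset.mem_filter.1 hi).2

lemma notMem_interval_iff (A : Algorithm 𝒳) (α γ : ℝ) {n : ℕ} (D : Fin n → 𝒳 × ℝ) (x : 𝒳)
    (y : ℝ) : y ∉ interval A α γ D x ↔
      (1 - α) * (1 + 1 / (n : ℝ)) * n ≤ ((Finset.univ.filter fun i =>
        -looFit A D i x + looResidual A D i < -y - γ).card : ℝ) ∨
      (1 - α) * (1 + 1 / (n : ℝ)) * n ≤ ((Finset.univ.filter fun i =>
        looFit A D i x + looResidual A D i < y - γ).card : ℝ) := by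
  rw [← quantile_lt_coe_iff, ← quantile_lt_coe_iff, interval, Set.mem_ofPred_eq, not_and_or]
  refine or_congr ?_ ?_
  · rw [← not_le, not_iff_not, EReal.sub_le_iff_le_add (by simp) (by simp), EReal.neg_le,
      show -y - γ = -(y + γ) by ring, EReal.coe_neg, EReal.coe_add]
  · rw [← not_le, not_iff_not, EReal.coe_sub, EReal.sub_le_iff_le_add (by simp) (by simp)]

/-- The test points that exceed, by more than `γ`, at least a fraction `(1 - α) (1 + 1 / n)` of the
leave-one-out residuals. -/
def exceedSet (A : Algorithm 𝒳) (α γ : ℝ) {n : ℕ} (D : Fin n → 𝒳 × ℝ) : Set (𝒳 × ℝ) :=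
  {z | (1 - α) * (1 + 1 / (n : ℝ)) * n ≤ ((Finset.univ.filter fun i =>
    looResidual A D i + γ < |z.2 - looFit A D i z.1|).card : ℝ)}

lemma mem_exceedSet_of_notMem_interval {A : Algorithm 𝒳} {α γ : ℝ} {n : ℕ}
    {D : Fin n → 𝒳 × ℝ} {z : 𝒳 × ℝ} (h : z.2 ∉ interval A α γ D z.1) :
    z ∈ exceedSet A α γ D := by
  rcases (notMem_interval_iff A α γ D z.1 z.2).1 h with h | h
  all_goals
    refine h.trans (Nat.cast_le.2 (Finset.card_le_card fun i hi => ?_))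
    simp only [Finset.mem_filter, Finset.mem_univ, true_and] at hi ⊢
    rw [lt_abs]
  · right; linarith
  · left; linarith

lemma measurable_looResidual (A : Algorithm 𝒳) {n : ℕ} (i : Fin n) {β : Type*}
    [MeasurableSpace β] {f : β → Fin n → 𝒳 × ℝ} (hf : Measurable f) :
    Measurable fun p => looResidual A (f p) i := by
  have h : Measurable fun p => f p i := (measurable_pi_apply i).comp hf
  unfold looResidual
  exact (h.snd.sub (measurable_looFit A i hf h.fst)).abs

lemma measurableSet_exceedSet (A : Algorithm 𝒳) (α γ : ℝ) (n : ℕ) :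
    MeasurableSet {p : (Fin n → 𝒳 × ℝ) × (𝒳 × ℝ) | p.2 ∈ exceedSet A α γ p.1} := by
  refine measurableSet_le_card_filter
    (p := fun (p : (Fin n → 𝒳 × ℝ) × (𝒳 × ℝ)) i =>
      looResidual A p.1 i + γ < |p.2.2 - looFit A p.1 i p.2.1|) (fun i => ?_) _
  exact measurableSet_lt ((measurable_looResidual A i measurable_fst).add_const γ)
    (measurable_snd.snd.sub (measurable_looFit A i measurable_fst measurable_snd.fst)).abs

end Interval

section Inflated

/-- The discrepancy at `X_k` between the model fitted to the training data without the `i`-th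
training point, and the model fitted to all training and test data without the point `k`. -/
def discrepancy (A : Algorithm 𝒳) {n m : ℕ} (ω : Fin n ⊕ Fin m → 𝒳 × ℝ) (i : Fin n)
    (k : Fin n ⊕ Fin m) : ℝ :=
  |fitOn A ((Finset.univ.erase i).map Function.Embedding.inl) ω (ω k).1 -
    fitOn A (Finset.univ.erase k) ω (ω k).1|

lemma measurable_discrepancy (A : Algorithm 𝒳) {n m : ℕ} (i : Fin n) (k : Fin n ⊕ Fin m) :
    Measurable fun ω : Fin n ⊕ Fin m → 𝒳 × ℝ => discrepancy A ω i k := by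
  have hk : Measurable fun ω : Fin n ⊕ Fin m → 𝒳 × ℝ => (ω k).1 := (measurable_pi_apply k).fst
  exact ((measurable_fitOn A _ (f := fun ω : Fin n ⊕ Fin m → 𝒳 × ℝ => ω) measurable_id hk).sub
    (measurable_fitOn A _ (f := fun ω : Fin n ⊕ Fin m → 𝒳 × ℝ => ω) measurable_id hk)).abs

lemma lintegral_discrepancy_le (A : Algorithm 𝒳) (P : ProbabilityMeasure (𝒳 × ℝ)) {n m : ℕ}
    {i : Fin n} {k : Fin n ⊕ Fin m} (hk : ∀ i', k = Sum.inl i' → i' = i) :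
    ∫⁻ ω : Fin n ⊕ Fin m → 𝒳 × ℝ, ENNReal.ofReal (discrepancy A ω i k)
      ∂(Measure.pi fun _ => (P : Measure (𝒳 × ℝ))) ≤ m * betaOutStar (n - 1) A P := by
  have hst : (Finset.univ.erase i).map (Function.Embedding.inl : Fin n ↪ Fin n ⊕ Fin m) ⊆
      Finset.univ.erase k := by
    intro l hl
    obtain ⟨i', hi', rfl⟩ := Finset.mem_map.1 hl
    refine Finset.mem_erase.2 ⟨fun h => Finset.ne_of_mem_erase hi' (hk i' h.symm),
      Finset.mem_univ _⟩
  have h := lintegral_fitOn_subset_le A P hst (Finset.notMem_erase k _)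
  have hn : 0 < n := i.pos
  have hc : n + m - 1 - (n - 1) = m := by omega
  simpa only [discrepancy, Finset.card_map, Finset.card_erase_of_mem (Finset.mem_univ _),
    Finset.card_univ, Fintype.card_fin, Fintype.card_sum, hc] using h

lemma measure_card_discrepancy_ge_le (A : Algorithm 𝒳) (P : ProbabilityMeasure (𝒳 × ℝ))
    {n m : ℕ} (hn : 0 < n) (hm : 0 < m) {b γ s : ℝ} (hb : 0 ≤ b) (hγ : 0 < γ) (hs : 0 < s)
    (hs3 : s ^ 3 = 2 * m * b / γ) (hβ : betaOutStar (n - 1) A P ≤ ENNReal.ofReal b) :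
    (Measure.pi fun _ : Fin n ⊕ Fin m => (P : Measure (𝒳 × ℝ))).real
      {ω | m * s ≤ ((Finset.univ.filter fun j : Fin m =>
        s * n ≤ ((Finset.univ.filter fun i : Fin n =>
          γ ≤ discrepancy A ω i (Sum.inl i) + discrepancy A ω i (Sum.inr j)).card : ℝ)).card : ℝ)}
      ≤ s := by
  set μ := Measure.pi fun _ : Fin n ⊕ Fin m => (P : Measure (𝒳 × ℝ)) with hμ
  have hmR : (0 : ℝ) < m := by exact_mod_cast hm
  have hnR : (0 : ℝ) < n := by exact_mod_cast hn
  set F : (Fin n ⊕ Fin m → 𝒳 × ℝ) → ℝ≥0∞ := fun ω => ∑ j : Fin m, ∑ i : Fin n,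
    (ENNReal.ofReal (discrepancy A ω i (Sum.inl i)) +
      ENNReal.ofReal (discrepancy A ω i (Sum.inr j))) with hF
  have hdm (i : Fin n) (k : Fin n ⊕ Fin m) :
      Measurable fun ω : Fin n ⊕ Fin m → 𝒳 × ℝ => ENNReal.ofReal (discrepancy A ω i k) :=
    (measurable_discrepancy A i k).ennreal_ofReal
  have hadd (j : Fin m) (i : Fin n) : Measurable fun ω : Fin n ⊕ Fin m → 𝒳 × ℝ =>
      ENNReal.ofReal (discrepancy A ω i (Sum.inl i)) +
        ENNReal.ofReal (discrepancy A ω i (Sum.inr j)) := (hdm i _).add (hdm i _)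
  have hsum (j : Fin m) : Measurable fun ω : Fin n ⊕ Fin m → 𝒳 × ℝ => ∑ i : Fin n,
      (ENNReal.ofReal (discrepancy A ω i (Sum.inl i)) +
        ENNReal.ofReal (discrepancy A ω i (Sum.inr j))) :=
    Finset.measurable_sum _ fun i _ => hadd j i
  have hFm : Measurable F := Finset.measurable_sum _ fun j _ => hsum j
  have hFi : ∫⁻ ω, F ω ∂μ ≤ ENNReal.ofReal (m * (n * (2 * m * b))) := by
    simp only [hF]
    rw [lintegral_finsetSum _ fun j _ => hsum j]
    simp_rw [lintegral_finsetSum _ fun (i : Fin n) _ => hadd _ i, lintegral_add_left (hdm _ _)]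
    calc
      _ ≤ ∑ j : Fin m, ∑ i : Fin n, ENNReal.ofReal (2 * m * b) := by
        refine Finset.sum_le_sum fun j _ => Finset.sum_le_sum fun i _ => ?_
        have h1 (k : Fin n ⊕ Fin m) (hk : ∀ i', k = Sum.inl i' → i' = i) :
            ∫⁻ ω, ENNReal.ofReal (discrepancy A ω i k) ∂μ ≤ ENNReal.ofReal (m * b) := by
          refine (lintegral_discrepancy_le A P hk).trans ?_
          rw [ENNReal.ofReal_mul hmR.le, ENNReal.ofReal_natCast]
          gcongr
        refine (add_le_add (h1 (Sum.inl i) fun i' h => (Sum.inl_injective h).symm)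
          (h1 (Sum.inr j) fun i' h => by simp at h)).trans ?_
        rw [← ENNReal.ofReal_add (by positivity) (by positivity)]
        exact ENNReal.ofReal_le_ofReal (by linarith)
      _ = _ := by
        simp only [Finset.sum_const, Finset.card_univ, Fintype.card_fin, nsmul_eq_mul]
        rw [ENNReal.ofReal_mul hmR.le, ENNReal.ofReal_mul hnR.le, ENNReal.ofReal_natCast,
          ENNReal.ofReal_natCast]
  set K : ℝ := m * s * (n * s * γ) with hK
  have hK0 : 0 < K := by positivity
  have hmarkov := (mul_meas_ge_le_lintegral (μ := μ) hFm (ENNReal.ofReal K)).trans hFi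
  set E := {ω | ENNReal.ofReal K ≤ F ω} with hE
  have hEs : μ.real E ≤ s := by
    have h1 := ENNReal.toReal_mono ENNReal.ofReal_ne_top hmarkov
    rw [ENNReal.toReal_mul, ENNReal.toReal_ofReal hK0.le, ENNReal.toReal_ofReal (by positivity),
      show (m * (n * (2 * m * b)) : ℝ) = K * s by
        rw [eq_div_iff hγ.ne'] at hs3
        rw [← hs3, hK]; ring] at h1
    exact le_of_mul_le_mul_left h1 hK0
  refine (measureReal_mono ?_).trans hEs
  intro ω hω
  simp only [Set.mem_ofPred_eq, hE, hF] at hω ⊢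
  have hnn (i : Fin n) (k : Fin n ⊕ Fin m) : 0 ≤ discrepancy A ω i k := abs_nonneg _
  have hFreal : F ω = ENNReal.ofReal (∑ j : Fin m, ∑ i : Fin n,
      (discrepancy A ω i (Sum.inl i) + discrepancy A ω i (Sum.inr j))) := by
    rw [ENNReal.ofReal_sum_of_nonneg fun j _ => Finset.sum_nonneg fun i _ =>
      add_nonneg (hnn _ _) (hnn _ _)]
    refine Finset.sum_congr rfl fun j _ => ?_
    rw [ENNReal.ofReal_sum_of_nonneg fun i _ => add_nonneg (hnn _ _) (hnn _ _)]
    refine Finset.sum_congr rfl fun i _ => ?_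
    rw [ENNReal.ofReal_add (hnn _ _) (hnn _ _)]
  change _ ≤ F ω
  rw [hFreal]
  refine ENNReal.ofReal_le_ofReal ?_
  have hinner (j : Fin m) : (if s * n ≤ ((Finset.univ.filter fun i : Fin n =>
      γ ≤ discrepancy A ω i (Sum.inl i) + discrepancy A ω i (Sum.inr j)).card : ℝ)
      then n * s * γ else 0) ≤
      ∑ i : Fin n, (discrepancy A ω i (Sum.inl i) + discrepancy A ω i (Sum.inr j)) := by
    split_ifs with h
    · calc
        n * s * γ ≤ ((Finset.univ.filter fun i : Fin n =>
            γ ≤ discrepancy A ω i (Sum.inl i) + discrepancy A ω i (Sum.inr j)).card : ℝ) * γ := by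
          gcongr; linarith
        _ = ∑ i : Fin n, (if γ ≤ discrepancy A ω i (Sum.inl i) + discrepancy A ω i (Sum.inr j)
            then γ else 0) := by
          rw [← Finset.sum_filter, Finset.sum_const, nsmul_eq_mul]
        _ ≤ _ := by
          refine Finset.sum_le_sum fun i _ => ?_
          split_ifs with h
          · exact h
          · exact add_nonneg (hnn _ _) (hnn _ _)
    · exact Finset.sum_nonneg fun i _ => add_nonneg (hnn _ _) (hnn _ _)
  refine le_trans ?_ (Finset.sum_le_sum fun j _ => hinner j)
  rw [← Finset.sum_filter, Finset.sum_const, nsmul_eq_mul, hK]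
  gcongr

/-- A training-conditional coverage bound for the inflated jackknife+ interval. -/
theorem measure_miscoverage_ge_le (A : Algorithm 𝒳) (P : ProbabilityMeasure (𝒳 × ℝ)) {α : ℝ}
    (hα : α ∈ Set.Icc (0 : ℝ) 1) {n m : ℕ} (hn : 0 < n) (hm : 0 < m) {b γ s η : ℝ} (hb : 0 ≤ b)
    (hγ : 0 < γ) (hs : 0 < s) (hη : 0 < η) (hs3 : s ^ 3 = 2 * m * b / γ)
    (hβ : betaOutStar (n - 1) A P ≤ ENNReal.ofReal b) :
    (sampleLaw P n).real {D | α + 3 * η + 2 * s ≤ miscoverage A P α γ D} ≤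
      2 / (m * η ^ 2) + 1 / (n * η ^ 2) + s := by
  classical
  have hmR : (0 : ℝ) < m := by exact_mod_cast hm
  have hnR : (0 : ℝ) < n := by exact_mod_cast hn
  have : IsProbabilityMeasure (sampleLaw P n) := by unfold sampleLaw; infer_instance
  set μ := Measure.pi fun _ : Fin n ⊕ Fin m => (P : Measure (𝒳 × ℝ)) with hμ
  have htest := measure_le_of_test_sample (sampleLaw P n) (P : Measure (𝒳 × ℝ)) hm
    (G := fun D => exceedSet A α γ D) (measurableSet_exceedSet A α γ n)
    (c := α + 2 * η + 2 * s) hη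
  have hmp := measurePreserving_sumPiEquivProdPi (fun _ : Fin n ⊕ Fin m => (P : Measure (𝒳 × ℝ)))
  have hmono : (sampleLaw P n).real {D | α + 3 * η + 2 * s ≤ miscoverage A P α γ D} ≤
      (sampleLaw P n).real {D | α + 2 * η + 2 * s + η ≤
        (P : Measure (𝒳 × ℝ)).real (exceedSet A α γ D)} := by
    refine measureReal_mono fun D hD => ?_
    simp only [Set.mem_ofPred_eq] at hD ⊢
    have : miscoverage A P α γ D ≤ (P : Measure (𝒳 × ℝ)).real (exceedSet A α γ D) :=
      measureReal_mono fun z hz => mem_exceedSet_of_notMem_interval hz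
    linarith
  have hpull : ((sampleLaw P n).prod (Measure.pi fun _ : Fin m => (P : Measure (𝒳 × ℝ)))).real
        {p | m * (α + 2 * η + 2 * s) ≤
          ((Finset.univ.filter fun j => p.2 j ∈ exceedSet A α γ p.1).card : ℝ)} =
      μ.real {ω | m * (α + 2 * η + 2 * s) ≤ ((Finset.univ.filter fun j =>
        ω (Sum.inr j) ∈ exceedSet A α γ fun i => ω (Sum.inl i)).card : ℝ)} := by
    rw [measureReal_def, measureReal_def, sampleLaw, ← hmp.measure_preimage_equiv]
    rfl
  have hrank := measure_card_rank_ge_le (P : Measure (𝒳 × ℝ)) hn hm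
    (r := fun ω k => score A ω k) (fun k => measurable_score A k)
    (fun π ω k => score_comp_perm A π ω k) (a := α + s) (by linarith [hα.1]) hη
  have hdisc := measure_card_discrepancy_ge_le A P hn hm hb hγ hs hs3 hβ
  have hfinal : μ.real {ω | m * (α + 2 * η + 2 * s) ≤ ((Finset.univ.filter fun j =>
        ω (Sum.inr j) ∈ exceedSet A α γ fun i => ω (Sum.inl i)).card : ℝ)} ≤
      (1 / (m * η ^ 2) + 1 / (n * η ^ 2)) + s := by
    refine le_trans (measureReal_mono ?_) ((measureReal_union_le _ _).trans
      (add_le_add hrank hdisc))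
    intro ω hω
    simp only [Set.mem_ofPred_eq, Set.mem_union] at hω ⊢
    by_contra! hcon
    obtain ⟨h1, h2⟩ := hcon
    refine absurd hω (not_le.2 ?_)
    set U := Finset.univ.filter fun j : Fin m =>
      (1 - (α + s)) * n ≤ ((Finset.univ.filter fun i : Fin n =>
        score A ω (Sum.inl i) < score A ω (Sum.inr j)).card : ℝ)
    set V := Finset.univ.filter fun j : Fin m =>
        s * n ≤ ((Finset.univ.filter fun i : Fin n =>
          γ ≤ discrepancy A ω i (Sum.inl i) + discrepancy A ω i (Sum.inr j)).card : ℝ)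
    have hsub : (Finset.univ.filter fun j =>
        ω (Sum.inr j) ∈ exceedSet A α γ fun i => ω (Sum.inl i)) ⊆ U ∪ V := by
      intro j hj
      have hjG := (Finset.mem_filter.1 hj).2
      rw [exceedSet, Set.mem_ofPred_eq] at hjG
      simp only [Finset.mem_filter, Finset.mem_univ, true_and, Finset.mem_union, U, V]
      by_contra! hc
      obtain ⟨hc1, hc2⟩ := hc
      have hsub2 : (Finset.univ.filter fun i : Fin n =>
          looResidual A (fun i => ω (Sum.inl i)) i + γ <
            |(ω (Sum.inr j)).2 - looFit A (fun i => ω (Sum.inl i)) i (ω (Sum.inr j)).1|) ⊆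
          (Finset.univ.filter fun i : Fin n =>
            score A ω (Sum.inl i) < score A ω (Sum.inr j)) ∪
          (Finset.univ.filter fun i : Fin n =>
            γ ≤ discrepancy A ω i (Sum.inl i) + discrepancy A ω i (Sum.inr j)) := by
        intro i hi
        simp only [Finset.mem_filter, Finset.mem_univ, true_and, Finset.mem_union] at hi ⊢
        by_contra! hcc
        obtain ⟨hc3, hc4⟩ := hcc
        rw [looResidual, looFit_eq_fitOn A Sum.inl_injective] at hi
        simp only [score, discrepancy] at hc3 hc4
        change |_ - fitOn A ((Finset.univ.erase i).map Function.Embedding.inl) ω _| + γ <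
          |_ - fitOn A ((Finset.univ.erase i).map Function.Embedding.inl) ω _| at hi
        set f := fitOn A ((Finset.univ.erase i).map Function.Embedding.inl) ω
        have e1 := abs_sub_le (ω (Sum.inl i)).2 (f (ω (Sum.inl i)).1)
          (fitOn A (Finset.univ.erase (Sum.inl i)) ω (ω (Sum.inl i)).1)
        have e2 := abs_sub_le (ω (Sum.inr j)).2
          (fitOn A (Finset.univ.erase (Sum.inr j)) ω (ω (Sum.inr j)).1) (f (ω (Sum.inr j)).1)
        rw [abs_sub_comm (fitOn A _ ω _) (f _)] at e2
        linarith
      have hcard := (Nat.cast_le (α := ℝ)).2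
        ((Finset.card_le_card hsub2).trans (Finset.card_union_le _ _))
      rw [Nat.cast_add] at hcard
      have hτ : (1 - α) * n ≤ (1 - α) * (1 + 1 / (n : ℝ)) * n := by
        have : 0 ≤ 1 - α := by linarith [hα.2]
        have : 0 ≤ 1 / (n : ℝ) := by positivity
        gcongr
        nlinarith
      linarith
    have hcard := (Nat.cast_le (α := ℝ)).2
      ((Finset.card_le_card hsub).trans (Finset.card_union_le _ _))
    rw [Nat.cast_add] at hcard
    linarith
  rw [hpull] at htest
  calc
    _ ≤ _ := hmono
    _ ≤ _ := htest
    _ ≤ 1 / (m * η ^ 2) + ((1 / (m * η ^ 2) + 1 / (n * η ^ 2)) + s) := by gcongr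
    _ = _ := by ring

end Inflated

section BoundedDensity

lemma measure_le_of_boundedDensity {P : ProbabilityMeasure (𝒳 × ℝ)} {B γ : ℝ} (hB : 0 ≤ B)
    (hγ : 0 ≤ γ) (hP : P ∈ boundedDensity 𝒳 B) {S : Set (𝒳 × ℝ)} (hS : MeasurableSet S)
    (hSγ : ∀ x, volume {y | (x, y) ∈ S} ≤ ENNReal.ofReal γ) :
    (P : Measure (𝒳 × ℝ)).real S ≤ γ * B := by
  obtain ⟨f, hf, hPf, hfB⟩ := hP
  refine ENNReal.toReal_le_of_le_ofReal (by positivity) ?_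
  have h := congrArg (fun μ : Measure (𝒳 × ℝ) => μ S) hPf
  rw [h, withDensity_apply _ hS, ← lintegral_indicator hS,
    lintegral_prod _ (hf.indicator hS).aemeasurable]
  calc
    _ ≤ ∫⁻ x, (⨆ y, f x y) * ENNReal.ofReal γ ∂((P : Measure (𝒳 × ℝ)).map Prod.fst) := by
      refine lintegral_mono fun x => ?_
      have hSx : MeasurableSet {y | (x, y) ∈ S} := measurable_prodMk_left hS
      calc
        _ ≤ ∫⁻ y, {y | (x, y) ∈ S}.indicator (fun _ => ⨆ y, f x y) y := by
          refine lintegral_mono fun y => ?_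
          by_cases hy : (x, y) ∈ S
          · rw [Set.indicator_of_mem hy, Set.indicator_of_mem (by exact hy)]
            exact le_iSup (f x) y
          · rw [Set.indicator_of_notMem hy]
            exact zero_le
        _ = (⨆ y, f x y) * volume {y | (x, y) ∈ S} := lintegral_indicator_const hSx _
        _ ≤ _ := by gcongr; exact hSγ x
    _ = (∫⁻ x, ⨆ y, f x y ∂((P : Measure (𝒳 × ℝ)).map Prod.fst)) * ENNReal.ofReal γ :=
      lintegral_mul_const' _ _ ENNReal.ofReal_ne_top
    _ ≤ ENNReal.ofReal B * ENNReal.ofReal γ := by gcongr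
    _ = _ := by rw [← ENNReal.ofReal_mul hB, mul_comm]

lemma volume_sdiff_shift_le {n : ℕ} (v : Fin n → ℝ) (c : ℝ) {γ : ℝ} :
    volume {y : ℝ | c ≤ ((Finset.univ.filter fun i => v i < y).card : ℝ) ∧
      ¬ c ≤ ((Finset.univ.filter fun i => v i < y - γ).card : ℝ)} ≤ ENNReal.ofReal γ := by
  have hle {y z : ℝ} (hy : c ≤ ((Finset.univ.filter fun i => v i < y).card : ℝ))
      (hz : ¬ c ≤ ((Finset.univ.filter fun i => v i < z - γ).card : ℝ)) : z - y ≤ γ := by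
    by_contra! h
    refine hz (hy.trans (Nat.cast_le.2 (Finset.card_le_card fun i hi => ?_)))
    simp only [Finset.mem_filter, Finset.mem_univ, true_and] at hi ⊢
    linarith
  refine (Real.volume_le_diam _).trans (Metric.ediam_le fun y hy z hz => ?_)
  rw [edist_dist, Real.dist_eq]
  refine ENNReal.ofReal_le_ofReal (abs_sub_le_iff.2 ⟨?_, ?_⟩)
  · exact hle hz.1 hy.2
  · exact hle hy.1 hz.2

lemma measure_card_lt_and_not_le {P : ProbabilityMeasure (𝒳 × ℝ)} {B γ : ℝ} (hB : 0 ≤ B)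
    (hγ : 0 ≤ γ) (hP : P ∈ boundedDensity 𝒳 B) {n : ℕ} {w : Fin n → 𝒳 → ℝ}
    (hw : ∀ i, Measurable (w i)) (c : ℝ) {g : ℝ} (hg : g = 1 ∨ g = -1) :
    (P : Measure (𝒳 × ℝ)).real
      {z | c ≤ ((Finset.univ.filter fun i => w i z.1 < g * z.2).card : ℝ) ∧
        ¬ c ≤ ((Finset.univ.filter fun i => w i z.1 < g * z.2 - γ).card : ℝ)} ≤ γ * B := by
  refine measure_le_of_boundedDensity hB hγ hP ?_ fun x => ?_
  · have h (d : ℝ) : MeasurableSet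
        {z : 𝒳 × ℝ | c ≤ ((Finset.univ.filter fun i => w i z.1 < g * z.2 - d).card : ℝ)} :=
      measurableSet_le_card_filter (p := fun (z : 𝒳 × ℝ) i => w i z.1 < g * z.2 - d)
        (fun i => measurableSet_lt ((hw i).comp measurable_fst)
          ((measurable_snd.const_mul g).sub_const d)) c
    have h0 := h 0
    simp only [sub_zero] at h0
    exact h0.inter (h γ).compl
  · have h := volume_sdiff_shift_le (fun i => w i x) c (γ := γ)
    rcases hg with rfl | rfl
    · simp only [one_mul]
      exact h
    · rw [← Measure.measure_preimage_neg] at h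
      simp only [neg_mul, one_mul]
      exact h

/-- If `Y` given `X` has a bounded density, then inflating the interval changes its miscoverage
rate only a little. -/
lemma miscoverage_zero_le (A : Algorithm 𝒳) {P : ProbabilityMeasure (𝒳 × ℝ)} {α B γ : ℝ}
    (hB : 0 ≤ B) (hγ : 0 ≤ γ) (hP : P ∈ boundedDensity 𝒳 B) {n : ℕ} (D : Fin n → 𝒳 × ℝ) :
    miscoverage A P α 0 D ≤ miscoverage A P α γ D + 2 * (γ * B) := by
  have hw (i : Fin n) : Measurable fun x => looFit A D i x :=
    measurable_looFit A i (f := fun _ => D) measurable_const measurable_id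
  have h1 := measure_card_lt_and_not_le hB hγ hP
    (w := fun i x => -looFit A D i x + looResidual A D i) (fun i => (hw i).neg.add_const _)
    ((1 - α) * (1 + 1 / (n : ℝ)) * n) (Or.inr rfl)
  have h2 := measure_card_lt_and_not_le hB hγ hP
    (w := fun i x => looFit A D i x + looResidual A D i) (fun i => (hw i).add_const _)
    ((1 - α) * (1 + 1 / (n : ℝ)) * n) (Or.inl rfl)
  simp only [neg_mul, one_mul] at h1 h2
  refine le_trans (measureReal_mono ?_) ((measureReal_union_le
    {z : 𝒳 × ℝ | z.2 ∉ interval A α γ D z.1} _).trans (add_le_add le_rfl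
      ((measureReal_union_le _ _).trans ((add_le_add h1 h2).trans_eq (two_mul _).symm))))
  intro z hz
  by_contra hcon
  rw [Set.mem_union, Set.mem_union, not_or, not_or] at hcon
  obtain ⟨hI, hcon1, hcon2⟩ := hcon
  rw [Set.mem_ofPred_eq, notMem_interval_iff] at hI hz
  rw [not_or] at hI
  simp only [sub_zero] at hz
  rcases hz with hz | hz
  · exact hcon1 ⟨hz, hI.1⟩
  · exact hcon2 ⟨hz, hI.2⟩

end BoundedDensity

section Limits

/-- The half-width `(4 M) ^ (-1/4)` of the deviations. -/
def deviation (M : ℕ) : ℝ := 1 / (4 * M : ℝ) ^ (1 / 4 : ℝ)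

lemma deviation_pos {M : ℕ} (hM : 0 < M) : 0 < deviation M := by
  have : (0 : ℝ) < M := by exact_mod_cast hM
  unfold deviation
  positivity

lemma mul_deviation_sq (M : ℕ) : M * deviation M ^ 2 = (1 / 2) * (M : ℝ) ^ (1 / 2 : ℝ) := by
  rcases M.eq_zero_or_pos with rfl | hM
  · simp
  have hM : (0 : ℝ) < M := by exact_mod_cast hM
  have h : (((4 * M : ℝ)) ^ (1 / 4 : ℝ)) ^ 2 = 2 * (M : ℝ) ^ (1 / 2 : ℝ) := by
    rw [← Real.rpow_mul_natCast (by positivity), Real.mul_rpow (by norm_num) hM.le,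
      show (4 : ℝ) = 2 ^ (2 : ℝ) by norm_num, ← Real.rpow_mul (by norm_num)]
    norm_num
  have h2 : ((M : ℝ) ^ (1 / 2 : ℝ)) ^ 2 = M := by
    rw [← Real.rpow_mul_natCast hM.le]; norm_num
  have h3 : 0 < (M : ℝ) ^ (1 / 2 : ℝ) := by positivity
  rw [deviation, div_pow, h, one_pow, mul_one_div, div_eq_iff (by positivity)]
  linear_combination -h2

lemma steps_pos {r : ℝ} (hr : 0 < r) : 0 < steps r :=
  Nat.ceil_pos.2 (Real.rpow_pos_of_pos hr _)

lemma tendsto_min_steps {r : ℕ → ℝ} (hr : ∀ n, 0 < r n) (hr0 : Tendsto r atTop (𝓝 0)) :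
    Tendsto (fun n => min n (steps (r n))) atTop atTop := by
  have h1 : Tendsto r atTop (𝓝[>] 0) :=
    tendsto_nhdsWithin_iff.2 ⟨hr0, Eventually.of_forall fun n => hr n⟩
  have h2 : Tendsto (fun n => steps (r n)) atTop atTop :=
    tendsto_nat_ceil_atTop.comp ((tendsto_rpow_neg_nhdsGT_zero (by norm_num)).comp h1)
  refine tendsto_atTop.2 fun c => ?_
  filter_upwards [tendsto_atTop.1 h2 c, eventually_ge_atTop c] with n h3 h4
  exact le_min h4 h3

lemma tendsto_steps_mul {r : ℕ → ℝ} (hr : ∀ n, 0 < r n) (hr0 : Tendsto r atTop (𝓝 0)) :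
    Tendsto (fun n => 2 * (steps (r n) : ℝ) * r n) atTop (𝓝 0) := by
  have h1 : Tendsto (fun n => 2 * (r n ^ (1 / 2 : ℝ) + r n)) atTop (𝓝 0) := by
    have h := ((hr0.rpow_const (p := 1 / 2) (Or.inr (by norm_num))).add hr0).const_mul 2
    rwa [Real.zero_rpow (by norm_num), add_zero, mul_zero] at h
  refine squeeze_zero (fun n => ?_) (fun n => ?_) h1
  · have := hr n
    positivity
  · have h2 : (steps (r n) : ℝ) ≤ r n ^ (-(1 / 2) : ℝ) + 1 :=
      (Nat.ceil_lt_add_one (Real.rpow_nonneg (hr n).le _)).le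
    have h3 : r n ^ (-(1 / 2) : ℝ) * r n = r n ^ (1 / 2 : ℝ) := by
      nth_rewrite 2 [← Real.rpow_one (r n)]
      rw [← Real.rpow_add (hr n)]
      norm_num
    have h4 := mul_le_mul_of_nonneg_right h2 (hr n).le
    linarith

lemma tendsto_steps_mul_rpow {r : ℕ → ℝ} (hr : ∀ n, 0 < r n) (hr0 : Tendsto r atTop (𝓝 0))
    {p : ℝ} (hp : 0 < p) :
    Tendsto (fun n => (2 * (steps (r n) : ℝ) * r n) ^ p) atTop (𝓝 0) := by
  have h := (tendsto_steps_mul hr hr0).rpow_const (p := p) (Or.inr hp.le)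
  rwa [Real.zero_rpow hp.ne'] at h

lemma tendsto_deviation {r : ℕ → ℝ} (hr : ∀ n, 0 < r n) (hr0 : Tendsto r atTop (𝓝 0)) :
    Tendsto (fun n => deviation (min n (steps (r n)))) atTop (𝓝 0) := by
  have h1 : Tendsto (fun n => (4 * (min n (steps (r n)) : ℕ) : ℝ)) atTop atTop :=
    (tendsto_natCast_atTop_atTop.comp (tendsto_min_steps hr hr0)).const_mul_atTop (by norm_num)
  exact tendsto_const_nhds.div_atTop ((tendsto_rpow_atTop (by norm_num)).comp h1)

lemma tendsto_failure_probability {r : ℕ → ℝ} (hr : ∀ n, 0 < r n) (hr0 : Tendsto r atTop (𝓝 0))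
    {p : ℝ} (hp : 0 < p) :
    Tendsto (fun n => ENNReal.ofReal (6 / ((min n (steps (r n)) : ℕ) : ℝ) ^ (1 / 2 : ℝ) +
      (2 * (steps (r n) : ℝ) * r n) ^ p)) atTop (𝓝 0) := by
  have h1 : Tendsto (fun n => ((min n (steps (r n)) : ℕ) : ℝ)) atTop atTop :=
    tendsto_natCast_atTop_atTop.comp (tendsto_min_steps hr hr0)
  have h2 : Tendsto (fun n => 6 / ((min n (steps (r n)) : ℕ) : ℝ) ^ (1 / 2 : ℝ)) atTop (𝓝 0) :=
    tendsto_const_nhds.div_atTop ((tendsto_rpow_atTop (by norm_num)).comp h1)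
  have h3 := ENNReal.tendsto_ofReal (h2.add (tendsto_steps_mul_rpow hr hr0 hp))
  simpa using h3

lemma epsInflated_eq (n : ℕ) (r : ℝ) : epsInflated n r =
    3 * deviation (min n (steps r)) + 2 * (2 * (steps r : ℝ) * r) ^ (1 / 3 : ℝ) := by
  rw [epsInflated, deviation, mul_one_div]

lemma epsUninflated_eq (n : ℕ) (r : ℝ) : epsUninflated n r =
    3 * deviation (min n (steps r)) + 4 * (2 * (steps r : ℝ) * r) ^ (1 / 4 : ℝ) := by
  rw [epsUninflated, deviation, mul_one_div]

end Limits

lemma sampleLaw_miscoverage_ge_le (A : Algorithm 𝒳) (P : ProbabilityMeasure (𝒳 × ℝ)) {α : ℝ}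
    (hα : α ∈ Set.Icc (0 : ℝ) 1) {n m : ℕ} (hn : 0 < n) (hm : 0 < m) {b γ s : ℝ} (hb : 0 ≤ b)
    (hγ : 0 < γ) (hs : 0 < s) (hs3 : s ^ 3 = 2 * m * b / γ)
    (hβ : betaOutStar (n - 1) A P ≤ ENNReal.ofReal b) :
    sampleLaw P n {D | α + (3 * deviation (min n m) + 2 * s) ≤ miscoverage A P α γ D} ≤
      ENNReal.ofReal (6 / ((min n m : ℕ) : ℝ) ^ (1 / 2 : ℝ) + s) := by
  have : IsProbabilityMeasure (sampleLaw P n) := by unfold sampleLaw; infer_instance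
  have hM : 0 < min n m := lt_min hn hm
  have hMR : (0 : ℝ) < (min n m : ℕ) := by exact_mod_cast hM
  have hη := deviation_pos hM
  have h := measure_miscoverage_ge_le A P hα hn hm hb hγ hs hη hs3 hβ
  rw [← ENNReal.ofReal_toReal (measure_ne_top (sampleLaw P n) _)]
  refine ENNReal.ofReal_le_ofReal ?_
  simp_rw [← add_assoc]
  refine h.trans ?_
  have h1 : (1 : ℝ) / (m * deviation (min n m) ^ 2) ≤
      1 / ((min n m : ℕ) * deviation (min n m) ^ 2) := by
    gcongr; exact min_le_right _ _
  have h2 : (1 : ℝ) / (n * deviation (min n m) ^ 2) ≤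
      1 / ((min n m : ℕ) * deviation (min n m) ^ 2) := by
    gcongr; exact min_le_left _ _
  have h3 : 3 * (1 / ((min n m : ℕ) * deviation (min n m) ^ 2)) =
      6 / ((min n m : ℕ) : ℝ) ^ (1 / 2 : ℝ) := by
    rw [mul_deviation_sq]
    field_simp
    norm_num
  have h4 : (2 : ℝ) / (m * deviation (min n m) ^ 2) = 2 * (1 / (m * deviation (min n m) ^ 2)) := by
    ring
  linarith

end JackknifePlus

end

open JackknifePlus

theorem theorem4 {𝒳 : Type*} [MeasurableSpace 𝒳] (α : ℝ) (hα : α ∈ Set.Icc (0 : ℝ) 1) :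
    (∀ b γ : ℕ → ℝ, (∀ n, 0 < b n) → (∀ n, 0 < γ n) →
      Tendsto (fun n => b n / γ n) atTop (𝓝 0) →
      ∃ ε : ℕ → ℝ, (∀ n, ε n = epsInflated n (b n / γ n)) ∧ Tendsto ε atTop (𝓝 0) ∧
        Tendsto (fun n => ⨆ (A : Algorithm 𝒳) (P : ProbabilityMeasure (𝒳 × ℝ))
            (_ : betaOutStar (n - 1) A P ≤ ENNReal.ofReal (b n)),
            sampleLaw P n {D | α + ε n ≤ miscoverage A P α (γ n) D})
          atTop (𝓝 0)) ∧
    (∀ b B : ℕ → ℝ, (∀ n, 0 < b n) → (∀ n, 0 < B n) →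
      Tendsto (fun n => b n * B n) atTop (𝓝 0) →
      ∃ ε : ℕ → ℝ, (∀ n, ε n = epsUninflated n (b n * B n)) ∧ Tendsto ε atTop (𝓝 0) ∧
        Tendsto (fun n => ⨆ (A : Algorithm 𝒳) (P : ProbabilityMeasure (𝒳 × ℝ))
            (_ : P ∈ boundedDensity 𝒳 (B n))
            (_ : betaOutStar (n - 1) A P ≤ ENNReal.ofReal (b n)),
            sampleLaw P n {D | α + ε n ≤ miscoverage A P α 0 D})
          atTop (𝓝 0)) := by
  refine ⟨fun b γ hb hγ h0 => ⟨_, fun n => rfl, ?_, ?_⟩,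
    fun b B hb hB h0 => ⟨_, fun n => rfl, ?_, ?_⟩⟩
  · have hr (n : ℕ) : 0 < b n / γ n := div_pos (hb n) (hγ n)
    simp_rw [epsInflated_eq]
    simpa using ((tendsto_deviation hr h0).const_mul 3).add
      ((tendsto_steps_mul_rpow hr h0 (p := 1 / 3) (by norm_num)).const_mul 2)
  · have hr (n : ℕ) : 0 < b n / γ n := div_pos (hb n) (hγ n)
    refine tendsto_of_tendsto_of_tendsto_of_le_of_le' tendsto_const_nhds
      (tendsto_failure_probability hr h0 (p := 1 / 3) (by norm_num))
      (Eventually.of_forall fun n => zero_le) ?_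
    filter_upwards [eventually_gt_atTop 0] with n hn
    refine iSup_le fun A => iSup_le fun P => iSup_le fun hβ => ?_
    have hm := steps_pos (hr n)
    have hmR : (0 : ℝ) < steps (b n / γ n) := by exact_mod_cast hm
    have hpos : 0 < 2 * (steps (b n / γ n) : ℝ) * (b n / γ n) := by have := hr n; positivity
    rw [epsInflated_eq]
    refine sampleLaw_miscoverage_ge_le A P hα hn hm (hb n).le (hγ n)
      (Real.rpow_pos_of_pos hpos _) ?_ hβ
    rw [← Real.rpow_mul_natCast hpos.le, mul_div_assoc]
    norm_num
  · have hr (n : ℕ) : 0 < b n * B n := mul_pos (hb n) (hB n)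
    simp_rw [epsUninflated_eq]
    simpa using ((tendsto_deviation hr h0).const_mul 3).add
      ((tendsto_steps_mul_rpow hr h0 (p := 1 / 4) (by norm_num)).const_mul 4)
  · have hr (n : ℕ) : 0 < b n * B n := mul_pos (hb n) (hB n)
    refine tendsto_of_tendsto_of_tendsto_of_le_of_le' tendsto_const_nhds
      (tendsto_failure_probability hr h0 (p := 1 / 4) (by norm_num))
      (Eventually.of_forall fun n => zero_le) ?_
    filter_upwards [eventually_gt_atTop 0] with n hn
    refine iSup_le fun A => iSup_le fun P => iSup_le fun hP => iSup_le fun hβ => ?_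
    have hm := steps_pos (hr n)
    have hmR : (0 : ℝ) < steps (b n * B n) := by exact_mod_cast hm
    have hpos : 0 < 2 * (steps (b n * B n) : ℝ) * (b n * B n) := by have := hr n; positivity
    rw [epsUninflated_eq]
    set t := (2 * (steps (b n * B n) : ℝ) * (b n * B n)) ^ (1 / 4 : ℝ) with ht
    have ht0 : 0 < t := Real.rpow_pos_of_pos hpos _
    have ht4 : t ^ 4 = 2 * (steps (b n * B n) : ℝ) * (b n * B n) := by
      rw [ht, ← Real.rpow_mul_natCast hpos.le]
      norm_num
    have hγ : 0 < t / B n := div_pos ht0 (hB n)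
    have hγB : t / B n * B n = t := div_mul_cancel₀ _ (hB n).ne'
    refine le_trans (measure_mono fun D hD => ?_)
      (sampleLaw_miscoverage_ge_le A P hα hn hm (hb n).le hγ ht0 ?_ hβ)
    · have h1 := miscoverage_zero_le A (α := α) (hB n).le hγ.le hP D
      rw [hγB] at h1
      simp only [Set.mem_ofPred_eq] at hD ⊢
      linarith
    · rw [div_div_eq_mul_div, eq_div_iff ht0.ne']
      linear_combination ht4
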